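/- Let $e_n(x)=\sqrt2\sin(\pi n x)$ and $\lambda_n=\pi^2n^2$, $n\in\mathbb N^+$, be the eigenfunctions and eigenvalues of $-\Delta$ on $(0,1)$ with Dirichlet boundary conditions, and for $s\in[0,1)$ let $H^{-s}(0,1)$ be the space of formal real series $f=\sum_{n\ge1} f_ne_n$ with $\sum_{n\ge1}\lambda_n^{-s}|f_n|^2<\infty$; write $\langle f,e_n\rangle=f_n$. Assume that there are constants $C,\alpha>0$ and $s\in[0,1)$ such that $f\in H^{-s}(0,1)$ and $$|\langle f,e_n\rangle|\ge C e^{-\alpha\pi^2n^2}\qquad\text{for all } n\in\mathbb N^+ .$$ Then for every $T>\alpha$ the controlled heat equation $$\partial_t z-\Delta z=f(x)h(t)\ \text{ in }(0,1)\times(0,T),\qquad z|_{x=0,1}=0,\qquad z(0,\cdot)=z_0,$$ with scalar control $h\in L^2(0,T)$, is null-controllable on $L^2(0,1)$ at time $T$: there is a constant $K>0$ such that for every $z_0\in L^2(0,1)$ there exists $h\in L^2(0,T)$ with $\|h\|_{L^2(0,T)}\le K\|z_0\|_{L^2(0,1)}$ whose mild solution $z\in C([0,T];L^2(0,1))$,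 $$z(t)=S(t)z_0+\int_0^t S(t-r)f\,h(r)\,dr,\qquad S(t)\Big(\sum_{n\ge1} a_ne_n\Big)=\sum_{n\ge1} e^{-\lambda_nt}a_ne_n,$$ satisfies $z(T)=0$. -/

import Mathlib

open MeasureTheory Set

noncomputable section

namespace HeatControl

/-- The real Hilbert space `L²(0,L)` (Lebesgue measure on the open interval `(0,L)`). -/
abbrev L2 (L : ℝ) : Type := Lp ℝ 2 (volume.restrict (Ioo (0 : ℝ) L))

/-- The Dirichlet eigenvalues `λₙ = π² n²` of `-Δ` on `(0,1)`. -/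
def eigenvalue (n : ℕ+) : ℝ := Real.pi ^ 2 * (n : ℝ) ^ 2

/-- The Dirichlet eigenfunctions `√2 sin(π n x)` of `-Δ` on `(0,1)`, as functions. -/
def sineFun (n : ℕ+) (x : ℝ) : ℝ := √2 * Real.sin (Real.pi * n * x)

theorem memLp_sineFun (n : ℕ+) : MemLp (sineFun n) 2 (volume.restrict (Ioo (0 : ℝ) 1)) := by
  refine MemLp.of_bound (C := √2) ?_ ?_
  · have h : Continuous (sineFun n) := by unfold sineFun; fun_prop
    exact h.aestronglyMeasurable
  · refine Filter.Eventually.of_forall fun x => ?_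
    have h := Real.abs_sin_le_one (Real.pi * n * x)
    have h2 := Real.sqrt_nonneg 2
    rw [sineFun, Real.norm_eq_abs, abs_mul, abs_of_nonneg h2]
    exact mul_le_of_le_one_right h2 h

/-- The Dirichlet eigenfunction `eₙ = √2 sin(π n ·)` as an element of `L²(0,1)`. -/
def e (n : ℕ+) : L2 1 := (memLp_sineFun n).toLp (sineFun n)

/-- The spectral Sobolev space `H^{-s}(0,1)`: formal sine series `f = ∑ fₙ eₙ` with
`∑ λₙ^{-s} |fₙ|² < ∞`. The number `coeff n` is `fₙ = ⟨f, eₙ⟩`. -/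
structure NegSobolev (s : ℝ) where
  coeff : ℕ+ → ℝ
  summable_coeff : Summable fun n : ℕ+ => eigenvalue n ^ (-s) * |coeff n| ^ 2

/-- The series `∑ e^{-λₙ t} aₙ eₙ` in `L²(0,1)`: the action at time `t` of the Dirichlet heat
semigroup on the formal sine series `∑ aₙ eₙ`. -/
def heatSeries (a : ℕ+ → ℝ) (t : ℝ) : L2 1 :=
  ∑' n : ℕ+, (Real.exp (-eigenvalue n * t) * a n) • e n

/-- The Dirichlet heat semigroup `S(t) = e^{tΔ}` on `L²(0,1)`, for `t ≥ 0`. -/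
def heat (t : ℝ) (z : L2 1) : L2 1 := heatSeries (fun n => inner ℝ z (e n)) t

/-- The extension of the Dirichlet heat semigroup to `H^{-s}(0,1)`, which maps `H^{-s}(0,1)` into
`L²(0,1)` for `t > 0`. (It is only used for almost every `t > 0`.) -/
def heatExt {s : ℝ} (t : ℝ) (f : NegSobolev s) : L2 1 := heatSeries f.coeff t

/-- `z ∈ C([0,T]; L²(0,1))` is the mild solution of
`∂ₜ z - Δ z = f(x) h(t)` on `(0,1) × (0,T)`, `z = 0` at `x = 0, 1`, `z(0,·) = z₀`, that is
`z(t) = S(t) z₀ + ∫₀ᵗ S(t-r) f h(r) dr` with an `L²(0,1)`-valued Bochner integral. -/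
structure IsMildSolution {s : ℝ} (f : NegSobolev s) (T : ℝ) (h : L2 T) (z₀ : L2 1)
    (z : ℝ → L2 1) : Prop where
  continuousOn : ContinuousOn z (Icc 0 T)
  integrable : ∀ t ∈ Icc 0 T,
    IntervalIntegrable (fun r => h r • heatExt (t - r) f) volume 0 t
  eq_mild : ∀ t ∈ Icc 0 T, z t = heat t z₀ + ∫ r in (0 : ℝ)..t, h r • heatExt (t - r) f

/-- Null-controllability on `L²(0,1)` at time `T` of `∂ₜ z - Δ z = f(x) h(t)` (Dirichlet boundary
conditions), with scalar control `h ∈ L²(0,T)` of cost at most a constant times `‖z₀‖`. -/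
def IsNullControllable {s : ℝ} (f : NegSobolev s) (T : ℝ) : Prop :=
  ∃ K : ℝ, 0 < K ∧ ∀ z₀ : L2 1, ∃ (h : L2 T) (z : ℝ → L2 1),
    IsMildSolution f T h z₀ z ∧ z T = 0 ∧ ‖h‖ ≤ K * ‖z₀‖

end HeatControl

end

/-!
In the sine basis, steering `z₀` to `0` at time `T` with the control `h r = v (T - r)` means solving
the moment problem `fₙ ∫₀ᵀ v(t) exp (-λₙ t) dt = -exp (-λₙ T) ⟨z₀, eₙ⟩`. The lower bound on `|fₙ|`
makes the required moments `O(exp (-(T - α) λₙ))`. With `τ = (T - α) / 4` the problem is solved by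
`v = ∑ βₙ qₙ`, `βₙ` being the required moments, where the `qₙ` are biorthogonal on `[0,τ]` to the
exponentials `exp (-λₖ t)` and `qₙ = O(exp (3 τ λₙ))`.

The `qₙ` come from one function `y` supported in `[0,τ]` whose Laplace transform is
`Φ(μ) sin √μ / √μ`, with `Φ` the transform of a bump `φ`. Since `sin √μ / √μ` is the power series
`∑ (-1)ⁱ μⁱ / (2i+1)!`, we have `y = ∑ (-1)ⁱ φ⁽ⁱ⁾ / (2i+1)!`, which converges if `φ` is of Gevrey
order `2`; Cauchy estimates in the complex plane give this for `φ = exp (-18 / t - 18 / (τ - t))`.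
Solving `Q' = λₙ Q + y` divides the transform by `μ - λₙ`, and `qₙ` is `Q` up to normalisation.

The control is continuous, so the Duhamel integral is controlled by the smoothing estimate
`‖S(t) f‖ ≲ t ^ (-σ / 2)`, which is integrable for all `σ < 2`. The final state is orthogonal to
every `eₙ` while lying in their closed span, hence it is zero.
-/

noncomputable section

namespace HeatControl

section Laplace

/-- The Laplace transform of the restriction of `g` to `[0,τ]`. -/
def laplace (τ : ℝ) (g : ℝ → ℝ) (μ : ℝ) : ℝ := ∫ t in (0 : ℝ)..τ, g t * Real.exp (-μ * t)

variable {τ : ℝ} {g g' : ℝ → ℝ}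

theorem intervalIntegrable_mul_exp (hg : Continuous g) (μ a b : ℝ) :
    IntervalIntegrable (fun t => g t * Real.exp (-μ * t)) volume a b :=
  (hg.mul (by fun_prop)).intervalIntegrable a b

theorem continuous_laplace (hg : Continuous g) : Continuous (laplace τ g) :=
  intervalIntegral.continuous_parametric_intervalIntegral_of_continuous' (by fun_prop) 0 τ

theorem laplace_const_mul (c : ℝ) (g : ℝ → ℝ) (μ : ℝ) :
    laplace τ (fun t => c * g t) μ = c * laplace τ g μ := by
  simp only [laplace, mul_assoc, intervalIntegral.integral_const_mul]

theorem laplace_add (hg : Continuous g) (hg' : Continuous g') (μ : ℝ) :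
    laplace τ (fun t => g t + g' t) μ = laplace τ g μ + laplace τ g' μ := by
  simp only [laplace, add_mul]
  exact intervalIntegral.integral_add (intervalIntegrable_mul_exp hg μ 0 τ)
    (intervalIntegrable_mul_exp hg' μ 0 τ)

theorem laplace_eq_zero_of_nonpos (hg : ∀ t ≤ 0, g t = 0) {t : ℝ} (ht : t ≤ 0) (μ : ℝ) :
    laplace t g μ = 0 := by
  refine intervalIntegral.integral_zero_ae (.of_forall fun s hs => ?_)
  rw [uIoc_of_ge ht] at hs
  rw [hg s hs.2, zero_mul]

theorem laplace_eq_of_le (hgc : Continuous g) (hg : ∀ t, τ ≤ t → g t = 0) {t : ℝ} (ht : τ ≤ t)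
    (μ : ℝ) : laplace t g μ = laplace τ g μ := by
  have hzero : ∫ s in τ..t, g s * Real.exp (-μ * s) = 0 := by
    refine intervalIntegral.integral_zero_ae (.of_forall fun s hs => ?_)
    rw [uIoc_of_le ht] at hs
    rw [hg s hs.1.le, zero_mul]
  rw [laplace, ← intervalIntegral.integral_add_adjacent_intervals
    (intervalIntegrable_mul_exp hgc μ 0 τ) (intervalIntegrable_mul_exp hgc μ τ t), hzero, add_zero,
    laplace]

theorem abs_laplace_le {M : ℝ} (hM : ∀ t, |g t| ≤ M) (hτ : 0 ≤ τ) {μ : ℝ} (hμ : 0 ≤ μ) :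
    |laplace τ g μ| ≤ M * τ := by
  have hbound : ∀ t ∈ uIoc 0 τ, ‖g t * Real.exp (-μ * t)‖ ≤ M := fun t ht => by
    rw [uIoc_of_le hτ] at ht
    have hexp : Real.exp (-μ * t) ≤ 1 := Real.exp_le_one_iff.2 (by nlinarith [ht.1])
    rw [norm_mul, Real.norm_of_nonneg (Real.exp_nonneg _)]
    exact (mul_le_of_le_one_right (norm_nonneg _) hexp).trans (hM t)
  have hle := intervalIntegral.norm_integral_le_of_norm_le_const hbound
  rwa [sub_zero, abs_of_nonneg hτ] at hle

theorem exp_mul_integral_le_laplace (hg : Continuous g) (hg0 : ∀ t, 0 ≤ g t) (hτ : 0 ≤ τ) {μ : ℝ}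
    (hμ : 0 ≤ μ) : Real.exp (-μ * τ) * (∫ t in (0 : ℝ)..τ, g t) ≤ laplace τ g μ := by
  rw [laplace, mul_comm, ← intervalIntegral.integral_mul_const]
  refine intervalIntegral.integral_mono_on hτ ((hg.mul_const _).intervalIntegrable _ _)
    (intervalIntegrable_mul_exp hg μ 0 τ) fun t ht => ?_
  exact mul_le_mul_of_nonneg_left (Real.exp_le_exp.2 (by nlinarith [ht.2])) (hg0 t)

theorem hasDerivAt_exp_mul (μ t : ℝ) :
    HasDerivAt (fun t => Real.exp (μ * t)) (μ * Real.exp (μ * t)) t := by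
  simpa [mul_comm] using ((hasDerivAt_id t).const_mul μ).exp

theorem laplace_deriv (hg : ∀ t, HasDerivAt g (g' t) t) (hg' : Continuous g') (h0 : g 0 = 0)
    (hτ : g τ = 0) (μ : ℝ) : laplace τ g' μ = μ * laplace τ g μ := by
  have hexp : Continuous fun t => -μ * Real.exp (-μ * t) := by fun_prop
  have hparts := intervalIntegral.integral_deriv_mul_eq_sub (a := 0) (b := τ)
    (fun t _ => hg t) (fun t _ => hasDerivAt_exp_mul (-μ) t) (hg'.intervalIntegrable 0 τ)
    (hexp.intervalIntegrable 0 τ)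
  have hgc : Continuous g := continuous_iff_continuousAt.2 fun t => (hg t).continuousAt
  have hint : IntervalIntegrable (fun t => g t * (-μ * Real.exp (-μ * t))) volume 0 τ :=
    (hgc.mul hexp).intervalIntegrable 0 τ
  rw [h0, hτ, intervalIntegral.integral_add (intervalIntegrable_mul_exp hg' μ 0 τ) hint] at hparts
  simp only [mul_left_comm (g _), intervalIntegral.integral_const_mul] at hparts
  rw [laplace, laplace]
  linarith

theorem hasSum_laplace {ι : Type*} [Countable ι] {F : ι → ℝ → ℝ} {M : ι → ℝ}
    (hF : ∀ i, Continuous (F i)) (hM : Summable M) (hFM : ∀ i t, |F i t| ≤ M i) (τ μ : ℝ) :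
    HasSum (fun i => laplace τ (F i) μ) (laplace τ (fun t => ∑' i, F i t) μ) := by
  have hexp : Continuous fun t : ℝ => Real.exp (-μ * t) := by fun_prop
  refine intervalIntegral.hasSum_integral_of_dominated_convergence
    (fun i t => M i * Real.exp (-μ * t)) (fun i => ((hF i).mul hexp).aestronglyMeasurable)
    (fun i => .of_forall fun t _ => ?_) (.of_forall fun t _ => hM.mul_right _) ?_
    (.of_forall fun t _ => ?_)
  · rw [norm_mul, Real.norm_of_nonneg (Real.exp_nonneg _)]
    exact mul_le_mul_of_nonneg_right (hFM i t) (Real.exp_nonneg _)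
  · simp only [tsum_mul_right]
    exact intervalIntegrable_mul_exp continuous_const μ 0 τ
  · have hsum : Summable fun i => F i t := .of_norm_bounded hM fun i => hFM i t
    exact hsum.hasSum.mul_right _

/-- The solution of `Q' = μ Q + g`, `Q 0 = 0`. When `μ` is a zero of the Laplace transform of `g`
on `[0,τ]`, it also vanishes at `τ`, and its Laplace transform is that of `g` divided by
`ν ↦ ν - μ`. -/
def expPrimitive (μ : ℝ) (g : ℝ → ℝ) (t : ℝ) : ℝ := Real.exp (μ * t) * laplace t g μ

variable {μ : ℝ}

theorem hasDerivAt_expPrimitive (hg : Continuous g) (μ t : ℝ) :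
    HasDerivAt (expPrimitive μ g) (μ * expPrimitive μ g t + g t) t := by
  have hlaplace : HasDerivAt (fun t => laplace t g μ) (g t * Real.exp (-μ * t)) t :=
    ((hg.mul (by fun_prop : Continuous fun s => Real.exp (-μ * s))).integral_hasStrictDerivAt
      0 t).hasDerivAt
  refine ((hasDerivAt_exp_mul μ t).mul hlaplace).congr_deriv ?_
  have hexp : Real.exp (μ * t) * Real.exp (-μ * t) = 1 := by rw [← Real.exp_add]; simp
  rw [expPrimitive]
  linear_combination g t * hexp

theorem continuous_expPrimitive (hg : Continuous g) (μ : ℝ) : Continuous (expPrimitive μ g) :=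
  continuous_iff_continuousAt.2 fun t => (hasDerivAt_expPrimitive hg μ t).continuousAt

theorem expPrimitive_of_nonpos (hg : ∀ t ≤ 0, g t = 0) {t : ℝ} (ht : t ≤ 0) (μ : ℝ) :
    expPrimitive μ g t = 0 := by
  rw [expPrimitive, laplace_eq_zero_of_nonpos hg ht, mul_zero]

theorem expPrimitive_of_le (hgc : Continuous g) (hg : ∀ t, τ ≤ t → g t = 0)
    (hμ : laplace τ g μ = 0) {t : ℝ} (ht : τ ≤ t) : expPrimitive μ g t = 0 := by
  rw [expPrimitive, laplace_eq_of_le hgc hg ht, hμ, mul_zero]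

theorem abs_expPrimitive_le (hgc : Continuous g) (hg0 : ∀ t ≤ 0, g t = 0)
    (hgτ : ∀ t, τ ≤ t → g t = 0) {M : ℝ} (hM : ∀ t, |g t| ≤ M) (hτ : 0 ≤ τ) (hμ0 : 0 ≤ μ)
    (hμ : laplace τ g μ = 0) (t : ℝ) :
    |expPrimitive μ g t| ≤ Real.exp (μ * τ) * (M * τ) := by
  have hM0 : 0 ≤ M := (abs_nonneg _).trans (hM 0)
  rcases le_total t 0 with ht0 | ht0
  · rw [expPrimitive_of_nonpos hg0 ht0, abs_zero]
    positivity
  rcases le_total τ t with htτ | htτ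
  · rw [expPrimitive_of_le hgc hgτ hμ htτ, abs_zero]
    positivity
  rw [expPrimitive, abs_mul, Real.abs_exp]
  calc Real.exp (μ * t) * |laplace t g μ|
      ≤ Real.exp (μ * t) * (M * t) := by gcongr; exact abs_laplace_le hM ht0 hμ0
    _ ≤ Real.exp (μ * τ) * (M * τ) := by gcongr

theorem sub_mul_laplace_expPrimitive (hg : Continuous g) (hμ : laplace τ g μ = 0) (ν : ℝ) :
    (ν - μ) * laplace τ (expPrimitive μ g) ν = laplace τ g ν := by
  have hQ := continuous_expPrimitive hg μ
  have hderiv := laplace_deriv (hasDerivAt_expPrimitive hg μ) ((hQ.const_mul μ).add hg)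
    (by simp [expPrimitive, laplace]) (by rw [expPrimitive, hμ, mul_zero]) ν
  rw [laplace_add (hQ.const_mul μ) hg, laplace_const_mul] at hderiv
  linear_combination -hderiv

end Laplace

section Gevrey

open Filter Metric Topology

theorem iteratedDeriv_eventuallyEq_re {F : ℂ → ℂ} {f : ℝ → ℝ} {x : ℝ} (hF : AnalyticAt ℂ F x)
    (hf : ∀ᶠ y in 𝓝 x, f y = (F y).re) (n : ℕ) :
    ∀ᶠ y in 𝓝 x, iteratedDeriv n f y = (iteratedDeriv n F y).re := by
  induction n with
  | zero => simpa only [iteratedDeriv_zero] using hf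
  | succ n ih =>
    have hanalytic : ∀ᶠ y : ℝ in 𝓝 x, AnalyticAt ℂ F y :=
      Complex.continuous_ofReal.continuousAt.eventually hF.eventually_analyticAt
    filter_upwards [ih.eventually_nhds, hanalytic] with y hy hFy
    have hderiv : HasDerivAt (iteratedDeriv n F) (iteratedDeriv (n + 1) F y) y := by
      rw [iteratedDeriv_succ, iteratedDeriv_eq_iterate]
      exact (hFy.iterated_deriv n).differentiableAt.hasDerivAt
    rw [iteratedDeriv_succ, EventuallyEq.deriv_eq hy, hderiv.real_of_complex.deriv]

theorem abs_iteratedDeriv_le_of_forall_mem_sphere_norm_le {F : ℂ → ℂ} {f : ℝ → ℝ} {x r M : ℝ}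
    (hr : 0 < r) (hF : DiffContOnCl ℂ F (ball x r)) (hf : ∀ᶠ y in 𝓝 x, f y = (F y).re)
    (hM : ∀ z ∈ sphere (x : ℂ) r, ‖F z‖ ≤ M) (n : ℕ) :
    |iteratedDeriv n f x| ≤ n.factorial * M / r ^ n := by
  have hanalytic : AnalyticAt ℂ F x :=
    hF.differentiableOn.analyticAt (isOpen_ball.mem_nhds (mem_ball_self hr))
  rw [(iteratedDeriv_eventuallyEq_re hanalytic hf n).self_of_nhds]
  exact (Complex.abs_re_le_norm _).trans
    (Complex.norm_iteratedDeriv_le_of_forall_mem_sphere_norm_le n hr hF hM)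

/-- A smooth bump supported in `[0,τ]`, with derivatives bounded by `(2i)! / 2^i`. It is
`exp (-18 / t - 18 / (τ - t))` on `(0,τ)`; the constant `18` makes the Cauchy estimates on the
circles of half the distance to the endpoints give that bound. -/
def gevreyBump (τ t : ℝ) : ℝ := expNegInvGlue (t / 18) * expNegInvGlue ((τ - t) / 18)

variable {τ t : ℝ}

theorem contDiff_gevreyBump (τ : ℝ) (n : ℕ∞) : ContDiff ℝ n (gevreyBump τ) :=
  (expNegInvGlue.contDiff.comp (by fun_prop)).mul (expNegInvGlue.contDiff.comp (by fun_prop))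

theorem hasDerivAt_iteratedDeriv_gevreyBump (τ : ℝ) (i : ℕ) (t : ℝ) :
    HasDerivAt (iteratedDeriv i (gevreyBump τ)) (iteratedDeriv (i + 1) (gevreyBump τ) t) t := by
  rw [iteratedDeriv_succ]
  exact ((contDiff_gevreyBump τ ⊤).differentiable_iteratedDeriv i
    (mod_cast WithTop.coe_lt_top i) t).hasDerivAt

theorem continuous_iteratedDeriv_gevreyBump (τ : ℝ) (i : ℕ) :
    Continuous (iteratedDeriv i (gevreyBump τ)) :=
  continuous_iff_continuousAt.2 fun t => (hasDerivAt_iteratedDeriv_gevreyBump τ i t).continuousAt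

theorem continuous_gevreyBump (τ : ℝ) : Continuous (gevreyBump τ) :=
  (contDiff_gevreyBump τ 0).continuous

theorem gevreyBump_nonneg (τ t : ℝ) : 0 ≤ gevreyBump τ t :=
  mul_nonneg (expNegInvGlue.nonneg _) (expNegInvGlue.nonneg _)

theorem gevreyBump_pos (ht : t ∈ Ioo 0 τ) : 0 < gevreyBump τ t :=
  mul_pos (expNegInvGlue.pos_of_pos (div_pos ht.1 (by norm_num)))
    (expNegInvGlue.pos_of_pos (div_pos (sub_pos.2 ht.2) (by norm_num)))

theorem integral_gevreyBump_pos (hτ : 0 < τ) : 0 < ∫ t in (0 : ℝ)..τ, gevreyBump τ t :=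
  intervalIntegral.intervalIntegral_pos_of_pos_on
    ((continuous_gevreyBump τ).intervalIntegrable 0 τ) (fun _ => gevreyBump_pos) hτ

theorem iteratedDeriv_gevreyBump_of_nonpos (i : ℕ) (ht : t ≤ 0) :
    iteratedDeriv i (gevreyBump τ) t = 0 := by
  have hzero : EqOn (gevreyBump τ) 0 (Iio 0) := fun s (hs : s < 0) => by
    rw [gevreyBump, expNegInvGlue.zero_of_nonpos (by linarith), zero_mul, Pi.zero_apply]
  have hderiv : EqOn (iteratedDeriv i (gevreyBump τ)) 0 (Iio 0) := fun s hs => by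
    rw [hzero.iteratedDeriv_of_isOpen isOpen_Iio i hs]; simp
  exact hderiv.of_subset_closure (continuous_iteratedDeriv_gevreyBump τ i).continuousOn
    continuousOn_const Iio_subset_Iic_self (closure_Iio (0 : ℝ)).ge ht

theorem iteratedDeriv_gevreyBump_of_le (i : ℕ) (ht : τ ≤ t) :
    iteratedDeriv i (gevreyBump τ) t = 0 := by
  have hzero : EqOn (gevreyBump τ) 0 (Ioi τ) := fun s (hs : τ < s) => by
    rw [gevreyBump, expNegInvGlue.zero_of_nonpos (x := (τ - s) / 18) (by linarith), mul_zero,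
      Pi.zero_apply]
  have hderiv : EqOn (iteratedDeriv i (gevreyBump τ)) 0 (Ioi τ) := fun s hs => by
    rw [hzero.iteratedDeriv_of_isOpen isOpen_Ioi i hs]; simp
  exact hderiv.of_subset_closure (continuous_iteratedDeriv_gevreyBump τ i).continuousOn
    continuousOn_const Ioi_subset_Ici_self (closure_Ioi τ).ge ht

/-- The analytic continuation of `gevreyBump τ` from `(0,τ)` to the strip `0 < re z < τ`. -/
def complexGevreyBump (τ : ℝ) (z : ℂ) : ℂ := Complex.exp (-(18 / z + 18 / (τ - z)))

theorem gevreyBump_eq_re (ht : t ∈ Ioo 0 τ) : gevreyBump τ t = (complexGevreyBump τ t).re := by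
  have hcast : complexGevreyBump τ t = (Real.exp (-(18 / t + 18 / (τ - t))) : ℝ) := by
    rw [complexGevreyBump]; push_cast; rfl
  rw [hcast, Complex.ofReal_re, gevreyBump, expNegInvGlue, expNegInvGlue,
    if_neg (div_pos ht.1 (by norm_num)).not_ge,
    if_neg (div_pos (sub_pos.2 ht.2) (by norm_num)).not_ge, ← Real.exp_add, inv_div, inv_div,
    neg_add]

theorem differentiableAt_complexGevreyBump {z : ℂ} (hz : z.re ∈ Ioo 0 τ) :
    DifferentiableAt ℂ (complexGevreyBump τ) z := by
  have hz0 : z ≠ 0 := fun h => hz.1.ne' (by rw [h, Complex.zero_re])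
  have hzτ : (τ : ℂ) - z ≠ 0 := fun h => hz.2.ne' (by rw [← Complex.ofReal_re τ, sub_eq_zero.1 h])
  unfold complexGevreyBump
  fun_prop (disch := assumption)

theorem re_inv_nonneg {z : ℂ} (hz : 0 ≤ z.re) : 0 ≤ (z⁻¹).re := by
  rw [Complex.inv_re]
  exact div_nonneg hz (Complex.normSq_nonneg z)

theorem le_re_inv_of_norm_sub_le {z : ℂ} {ρ : ℝ} (hρ : 0 < ρ) (hz : ‖z - ρ‖ ≤ ρ / 2) :
    2 / (9 * ρ) ≤ (z⁻¹).re := by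
  have hre : ρ / 2 ≤ z.re := by
    have hsub := (abs_le.1 ((Complex.abs_re_le_norm (z - ρ)).trans hz)).1
    rw [Complex.sub_re, Complex.ofReal_re] at hsub
    linarith
  have hnorm : ‖z‖ ≤ 3 * ρ / 2 := by
    have htri := norm_add_le (z - ρ) (ρ : ℂ)
    rw [sub_add_cancel, Complex.norm_of_nonneg hρ.le] at htri
    linarith
  have hz0 : 0 < ‖z‖ := norm_pos_iff.2 fun h => by rw [h, Complex.zero_re] at hre; linarith
  rw [Complex.inv_re, Complex.normSq_eq_norm_sq]
  calc 2 / (9 * ρ) = ρ / 2 / (3 * ρ / 2) ^ 2 := by field_simp; norm_num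
    _ ≤ z.re / ‖z‖ ^ 2 := by gcongr; linarith

theorem norm_complexGevreyBump_le {ρ : ℝ} {z : ℂ} (ht : t ∈ Ioo 0 τ) (hρ : ρ = min t (τ - t))
    (hz : ‖z - t‖ ≤ ρ / 2) : ‖complexGevreyBump τ z‖ ≤ Real.exp (-(4 / ρ)) := by
  have hτt : 0 < τ - t := sub_pos.2 ht.2
  have hρ0 : 0 < ρ := hρ ▸ lt_min ht.1 hτt
  have hz' : ‖(τ - z) - (τ - t : ℝ)‖ ≤ ρ / 2 := by
    rw [Complex.ofReal_sub, sub_sub_sub_cancel_left, norm_sub_rev]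
    exact hz
  have hre := abs_le.1 ((Complex.abs_re_le_norm (z - t)).trans hz)
  rw [Complex.sub_re, Complex.ofReal_re] at hre
  have hρt : ρ ≤ t := hρ ▸ min_le_left _ _
  have hρτ : ρ ≤ τ - t := hρ ▸ min_le_right _ _
  have hinv : 0 ≤ (z⁻¹).re := re_inv_nonneg (by linarith)
  have hinv' : 0 ≤ ((τ - z : ℂ)⁻¹).re :=
    re_inv_nonneg (by rw [Complex.sub_re, Complex.ofReal_re]; linarith)
  have hsum : 2 / (9 * ρ) ≤ (z⁻¹).re + ((τ - z : ℂ)⁻¹).re := by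
    rcases min_choice t (τ - t) with hmin | hmin <;> rw [hmin] at hρ
    · rw [← hρ] at hz
      linarith [le_re_inv_of_norm_sub_le hρ0 hz]
    · rw [← hρ] at hz'
      linarith [le_re_inv_of_norm_sub_le hρ0 hz']
  have hscale : 4 / ρ = 18 * (2 / (9 * ρ)) := by field_simp; norm_num
  rw [complexGevreyBump, Complex.norm_exp, Real.exp_le_exp, Complex.neg_re, neg_le_neg_iff,
    div_eq_mul_inv _ z, div_eq_mul_inv _ (τ - z : ℂ), ← mul_add, hscale]
  simpa using hsum

theorem factorial_mul_exp_neg_div_le (i : ℕ) {ρ : ℝ} (hρ : 0 < ρ) :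
    i.factorial * Real.exp (-(4 / ρ)) / (ρ / 2) ^ i ≤ ((2 * i).factorial : ℝ) / 2 ^ i := by
  have hexp : (4 / ρ) ^ i * Real.exp (-(4 / ρ)) ≤ i.factorial := by
    have hpow := Real.pow_div_factorial_le_exp (4 / ρ) (by positivity) i
    rw [div_le_iff₀ (by positivity)] at hpow
    rwa [Real.exp_neg, ← div_eq_mul_inv, div_le_iff₀ (Real.exp_pos _), mul_comm]
  have hfac : (i.factorial : ℝ) * i.factorial ≤ (2 * i).factorial := by
    rw [two_mul]
    exact mod_cast Nat.le_of_dvd (Nat.factorial_pos _)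
      (Nat.factorial_mul_factorial_dvd_factorial_add i i)
  calc i.factorial * Real.exp (-(4 / ρ)) / (ρ / 2) ^ i
      = i.factorial * ((4 / ρ) ^ i * Real.exp (-(4 / ρ))) / 2 ^ i := by
        rw [show (4 : ℝ) / ρ = 2 / (ρ / 2) by field_simp; norm_num, div_pow 2]
        field_simp
    _ ≤ i.factorial * i.factorial / 2 ^ i := by gcongr
    _ ≤ (2 * i).factorial / 2 ^ i := by gcongr

theorem abs_iteratedDeriv_gevreyBump_le (τ : ℝ) (i : ℕ) (t : ℝ) :
    |iteratedDeriv i (gevreyBump τ) t| ≤ ((2 * i).factorial : ℝ) / 2 ^ i := by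
  rcases le_or_gt t 0 with ht0 | ht0
  · rw [iteratedDeriv_gevreyBump_of_nonpos i ht0, abs_zero]
    positivity
  rcases le_or_gt τ t with htτ | htτ
  · rw [iteratedDeriv_gevreyBump_of_le i htτ, abs_zero]
    positivity
  set ρ := min t (τ - t) with hρ
  have hρ0 : 0 < ρ := lt_min ht0 (sub_pos.2 htτ)
  have hdiff : DiffContOnCl ℂ (complexGevreyBump τ) (ball t (ρ / 2)) := by
    refine DifferentiableOn.diffContOnCl fun z hz =>
      (differentiableAt_complexGevreyBump ?_).differentiableWithinAt
    rw [closure_ball _ (by positivity), mem_closedBall, dist_eq_norm] at hz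
    have hre := abs_le.1 ((Complex.abs_re_le_norm (z - t)).trans hz)
    rw [Complex.sub_re, Complex.ofReal_re] at hre
    constructor <;> linarith [min_le_left t (τ - t), min_le_right t (τ - t)]
  have hreal : ∀ᶠ y in 𝓝 t, gevreyBump τ y = (complexGevreyBump τ y).re := by
    filter_upwards [Ioo_mem_nhds ht0 htτ] with y hy using gevreyBump_eq_re hy
  exact (abs_iteratedDeriv_le_of_forall_mem_sphere_norm_le (by positivity) hdiff hreal
    (fun z hz => norm_complexGevreyBump_le ⟨ht0, htτ⟩ hρ (mem_sphere_iff_norm.1 hz).le) i).trans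
    (factorial_mul_exp_neg_div_le i hρ0)

end Gevrey

section FlatTrace

open Filter Topology

variable {τ t : ℝ}

/-- The terms of `flatTrace`. -/
def flatTerm (τ : ℝ) (i : ℕ) (t : ℝ) : ℝ :=
  (-1) ^ i / ((2 * i + 1).factorial : ℝ) * iteratedDeriv i (gevreyBump τ) t

/-- The flat function `∑ (-1)^i φ^(i) / (2i+1)!` built on the bump `φ`. Its Laplace transform is
that of `φ` times `sin √μ / √μ`, so it vanishes at the eigenvalues of `-Δ`. -/
def flatTrace (τ t : ℝ) : ℝ := ∑' i, flatTerm τ i t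

theorem abs_flatTerm_le (τ : ℝ) (i : ℕ) (t : ℝ) : |flatTerm τ i t| ≤ (1 / 2) ^ i := by
  rw [flatTerm, abs_mul, abs_div, abs_pow, abs_neg, abs_one, one_pow, Nat.abs_cast]
  calc 1 / ((2 * i + 1).factorial : ℝ) * |iteratedDeriv i (gevreyBump τ) t|
      ≤ 1 / ((2 * i + 1).factorial : ℝ) * (((2 * i + 1).factorial : ℝ) / 2 ^ i) := by
        gcongr
        refine (abs_iteratedDeriv_gevreyBump_le τ i t).trans ?_
        gcongr
        exact Nat.le_succ _
    _ = (1 / 2) ^ i := by rw [one_div_pow]; field_simp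

theorem continuous_flatTerm (τ : ℝ) (i : ℕ) : Continuous (flatTerm τ i) :=
  continuous_const.mul (continuous_iteratedDeriv_gevreyBump τ i)

theorem continuous_flatTrace (τ : ℝ) : Continuous (flatTrace τ) :=
  continuous_tsum (continuous_flatTerm τ) summable_geometric_two (abs_flatTerm_le τ)

theorem abs_flatTrace_le (τ t : ℝ) : |flatTrace τ t| ≤ 2 :=
  tsum_of_norm_bounded (f := fun i => flatTerm τ i t) hasSum_geometric_two
    fun i => abs_flatTerm_le τ i t

theorem flatTrace_of_nonpos (ht : t ≤ 0) : flatTrace τ t = 0 := by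
  simp only [flatTrace, flatTerm, iteratedDeriv_gevreyBump_of_nonpos _ ht, mul_zero, tsum_zero]

theorem flatTrace_of_le (ht : τ ≤ t) : flatTrace τ t = 0 := by
  simp only [flatTrace, flatTerm, iteratedDeriv_gevreyBump_of_le _ ht, mul_zero, tsum_zero]

theorem laplace_iteratedDeriv_gevreyBump (τ μ : ℝ) (i : ℕ) :
    laplace τ (iteratedDeriv i (gevreyBump τ)) μ = μ ^ i * laplace τ (gevreyBump τ) μ := by
  induction i with
  | zero => rw [iteratedDeriv_zero, pow_zero, one_mul]
  | succ i ih =>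
    rw [laplace_deriv (hasDerivAt_iteratedDeriv_gevreyBump τ i)
      (continuous_iteratedDeriv_gevreyBump τ (i + 1)) (iteratedDeriv_gevreyBump_of_nonpos i le_rfl)
      (iteratedDeriv_gevreyBump_of_le i le_rfl), ih, pow_succ']
    ring

theorem laplace_flatTerm (τ μ : ℝ) (i : ℕ) : laplace τ (flatTerm τ i) μ =
    (-1) ^ i / ((2 * i + 1).factorial : ℝ) * (μ ^ i * laplace τ (gevreyBump τ) μ) := by
  rw [← laplace_iteratedDeriv_gevreyBump]
  exact laplace_const_mul _ _ _

theorem mul_laplace_flatTrace (τ m : ℝ) :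
    m * laplace τ (flatTrace τ) (m ^ 2) = Real.sin m * laplace τ (gevreyBump τ) (m ^ 2) := by
  have hflat := (hasSum_laplace (continuous_flatTerm τ) summable_geometric_two (abs_flatTerm_le τ)
    τ (m ^ 2)).mul_left m
  refine hflat.unique (((Real.hasSum_sin m).mul_right _).congr_fun fun i => ?_)
  rw [laplace_flatTerm]
  ring

theorem laplace_flatTrace_eq_zero {m : ℝ} (hm : m ≠ 0) (hsin : Real.sin m = 0) :
    laplace τ (flatTrace τ) (m ^ 2) = 0 := by
  have h := mul_laplace_flatTrace τ m
  rw [hsin, zero_mul] at h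
  exact (mul_eq_zero.1 h).resolve_left hm

theorem two_mul_sq_mul_laplace_expPrimitive_flatTrace {m : ℝ} (hm : m ≠ 0)
    (hsin : Real.sin m = 0) :
    2 * m ^ 2 * laplace τ (expPrimitive (m ^ 2) (flatTrace τ)) (m ^ 2)
      = Real.cos m * laplace τ (gevreyBump τ) (m ^ 2) := by
  set Q := laplace τ (expPrimitive (m ^ 2) (flatTrace τ))
  set Φ := laplace τ (gevreyBump τ)
  have hQ : Continuous Q :=
    continuous_laplace (continuous_expPrimitive (continuous_flatTrace τ) (m ^ 2))
  have hΦ : Continuous Φ := continuous_laplace (continuous_gevreyBump τ)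
  have hquot : ∀ x ≠ m, x * (x + m) * Q (x ^ 2) = slope Real.sin m x * Φ (x ^ 2) := fun x hx => by
    have hdiv := sub_mul_laplace_expPrimitive (continuous_flatTrace τ)
      (laplace_flatTrace_eq_zero (τ := τ) hm hsin) (x ^ 2)
    have hsub : x - m ≠ 0 := sub_ne_zero.2 hx
    rw [slope_def_field, hsin, sub_zero, div_mul_eq_mul_div, eq_div_iff hsub]
    linear_combination x * hdiv + mul_laplace_flatTrace τ x
  have hleft : Tendsto (fun x => x * (x + m) * Q (x ^ 2)) (𝓝[≠] m) (𝓝 (m * (m + m) * Q (m ^ 2))) :=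
    (Continuous.tendsto (by fun_prop) m).mono_left nhdsWithin_le_nhds
  have hright : Tendsto (fun x => slope Real.sin m x * Φ (x ^ 2)) (𝓝[≠] m)
      (𝓝 (Real.cos m * Φ (m ^ 2))) :=
    (Real.hasDerivAt_sin m).tendsto_slope.mul
      ((Continuous.tendsto (by fun_prop) m).mono_left nhdsWithin_le_nhds)
  have hlim := tendsto_nhds_unique_of_eventuallyEq hleft hright
    (eventually_mem_nhdsWithin.mono hquot)
  linear_combination hlim

end FlatTrace

section Moments

theorem eigenvalue_eq_sq (n : ℕ+) : eigenvalue n = (Real.pi * n) ^ 2 := by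
  rw [eigenvalue, mul_pow]

theorem pi_mul_pnat_ne_zero (n : ℕ+) : Real.pi * (n : ℝ) ≠ 0 :=
  mul_ne_zero Real.pi_ne_zero (by exact_mod_cast n.ne_zero)

theorem one_le_eigenvalue (n : ℕ+) : 1 ≤ eigenvalue n := by
  have hn : (1 : ℝ) ≤ n := mod_cast one_le (a := n)
  have hpi : 1 ≤ Real.pi := by linarith [Real.pi_gt_three]
  rw [eigenvalue_eq_sq]
  exact one_le_pow₀ (one_le_mul_of_one_le_of_one_le hpi hn)

theorem eigenvalue_pos (n : ℕ+) : 0 < eigenvalue n := one_pos.trans_le (one_le_eigenvalue n)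

theorem eigenvalue_injective : Function.Injective eigenvalue := fun n k h => by
  rw [eigenvalue, eigenvalue, mul_right_inj' (by positivity), sq_eq_sq₀ (by positivity)
    (by positivity)] at h
  exact_mod_cast h

theorem sin_pi_mul_pnat (n : ℕ+) : Real.sin (Real.pi * n) = 0 := by
  rw [mul_comm]
  exact_mod_cast Real.sin_nat_mul_pi (n : ℕ)

theorem abs_cos_pi_mul_pnat (n : ℕ+) : |Real.cos (Real.pi * n)| = 1 := by
  rcases Real.sin_eq_zero_iff_cos_eq.1 (sin_pi_mul_pnat n) with h | h <;> simp [h]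

theorem summable_inv_eigenvalue : Summable fun n : ℕ+ => (eigenvalue n)⁻¹ := by
  simp only [eigenvalue, mul_inv]
  exact (((Real.summable_nat_pow_inv (p := 2)).2 one_lt_two).comp_injective
    PNat.coe_injective).mul_left _

theorem summable_exp_neg_mul_eigenvalue {c : ℝ} (hc : 0 < c) :
    Summable fun n : ℕ+ => Real.exp (-(c * eigenvalue n)) := by
  refine .of_nonneg_of_le (fun n => (Real.exp_nonneg _)) (fun n => ?_)
    (summable_inv_eigenvalue.mul_left c⁻¹)
  have hpos := eigenvalue_pos n
  rw [Real.exp_neg, ← mul_inv]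
  gcongr
  linarith [Real.add_one_le_exp (c * eigenvalue n)]

/-- The family biorthogonal in `L²(0,τ)` to the exponentials `exp (-λₖ t)`, with
`|biorthogonal τ n|` at most a constant times `exp (3 τ λₙ)`. -/
def biorthogonal (τ : ℝ) (n : ℕ+) (t : ℝ) : ℝ :=
  2 * eigenvalue n / (Real.cos (Real.pi * n) * laplace τ (gevreyBump τ) (eigenvalue n)) *
    expPrimitive (eigenvalue n) (flatTrace τ) t

variable {τ : ℝ}

theorem laplace_flatTrace_eigenvalue (τ : ℝ) (n : ℕ+) :
    laplace τ (flatTrace τ) (eigenvalue n) = 0 := by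
  rw [eigenvalue_eq_sq, laplace_flatTrace_eq_zero (pi_mul_pnat_ne_zero n) (sin_pi_mul_pnat n)]

theorem exp_mul_integral_le_laplace_gevreyBump (hτ : 0 < τ) (n : ℕ+) :
    Real.exp (-eigenvalue n * τ) * (∫ t in (0 : ℝ)..τ, gevreyBump τ t)
      ≤ laplace τ (gevreyBump τ) (eigenvalue n) :=
  exp_mul_integral_le_laplace (continuous_gevreyBump τ) (gevreyBump_nonneg τ) hτ.le
    (eigenvalue_pos n).le

theorem laplace_gevreyBump_pos (hτ : 0 < τ) (n : ℕ+) :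
    0 < laplace τ (gevreyBump τ) (eigenvalue n) :=
  (mul_pos (Real.exp_pos _) (integral_gevreyBump_pos hτ)).trans_le
    (exp_mul_integral_le_laplace_gevreyBump hτ n)

theorem continuous_biorthogonal (τ : ℝ) (n : ℕ+) : Continuous (biorthogonal τ n) :=
  (continuous_expPrimitive (continuous_flatTrace τ) _).const_mul _

theorem biorthogonal_of_le (n : ℕ+) {t : ℝ} (ht : τ ≤ t) : biorthogonal τ n t = 0 := by
  rw [biorthogonal, expPrimitive_of_le (continuous_flatTrace τ) (fun _ => flatTrace_of_le)
    (laplace_flatTrace_eigenvalue τ n) ht, mul_zero]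

theorem laplace_biorthogonal (hτ : 0 < τ) (n k : ℕ+) :
    laplace τ (biorthogonal τ n) (eigenvalue k) = if n = k then 1 else 0 := by
  unfold biorthogonal
  rw [laplace_const_mul]
  split_ifs with h
  · subst h
    have hΦ := (laplace_gevreyBump_pos hτ n).ne'
    have hcos : Real.cos (Real.pi * n) ≠ 0 := abs_ne_zero.1 (by rw [abs_cos_pi_mul_pnat]; simp)
    have hdiag := two_mul_sq_mul_laplace_expPrimitive_flatTrace (τ := τ) (pi_mul_pnat_ne_zero n)
      (sin_pi_mul_pnat n)
    rw [← eigenvalue_eq_sq] at hdiag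
    rw [div_mul_eq_mul_div, hdiag, div_self (mul_ne_zero hcos hΦ)]
  · have hne : eigenvalue k - eigenvalue n ≠ 0 :=
      sub_ne_zero.2 fun h' => h (eigenvalue_injective h').symm
    have hoff := sub_mul_laplace_expPrimitive (continuous_flatTrace τ)
      (laplace_flatTrace_eigenvalue τ n) (eigenvalue k)
    rw [laplace_flatTrace_eigenvalue] at hoff
    rw [(mul_eq_zero.1 hoff).resolve_left hne, mul_zero]

theorem abs_biorthogonal_le (hτ : 0 < τ) (n : ℕ+) (t : ℝ) :
    |biorthogonal τ n t|
      ≤ 4 / (∫ t in (0 : ℝ)..τ, gevreyBump τ t) * Real.exp (3 * τ * eigenvalue n) := by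
  set P := ∫ t in (0 : ℝ)..τ, gevreyBump τ t
  have hP : 0 < P := integral_gevreyBump_pos hτ
  have hlam := eigenvalue_pos n
  have hQ := abs_expPrimitive_le (continuous_flatTrace τ) (fun _ => flatTrace_of_nonpos)
    (fun _ => flatTrace_of_le) (abs_flatTrace_le τ) hτ.le hlam.le
    (laplace_flatTrace_eigenvalue τ n) t
  have hlin : τ * eigenvalue n ≤ Real.exp (τ * eigenvalue n) := by
    linarith [Real.add_one_le_exp (τ * eigenvalue n)]
  rw [biorthogonal, abs_mul, abs_div, abs_mul (Real.cos _), abs_cos_pi_mul_pnat, one_mul,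
    abs_of_pos (laplace_gevreyBump_pos hτ n), abs_of_pos (by positivity : 0 < 2 * eigenvalue n)]
  calc 2 * eigenvalue n / laplace τ (gevreyBump τ) (eigenvalue n) *
        |expPrimitive (eigenvalue n) (flatTrace τ) t|
      ≤ 2 * eigenvalue n / (Real.exp (-eigenvalue n * τ) * P) *
          (Real.exp (eigenvalue n * τ) * (2 * τ)) := by
        gcongr
        exact exp_mul_integral_le_laplace_gevreyBump hτ n
    _ = 4 / P * (τ * eigenvalue n) * Real.exp (τ * eigenvalue n) ^ 2 := by
        rw [neg_mul, Real.exp_neg, mul_comm (eigenvalue n) τ]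
        field_simp
        norm_num
    _ ≤ 4 / P * Real.exp (τ * eigenvalue n) * Real.exp (τ * eigenvalue n) ^ 2 := by gcongr
    _ = 4 / P * Real.exp (3 * τ * eigenvalue n) := by
        rw [mul_assoc, ← pow_succ', ← Real.exp_nat_mul]
        norm_num [mul_assoc]

theorem exists_laplace_eq (hτ : 0 < τ) : ∃ K > 0, ∀ (β : ℕ+ → ℝ) (B : ℝ),
    (∀ n, |β n| ≤ B * Real.exp (-(4 * τ * eigenvalue n))) →
      ∃ v : ℝ → ℝ, Continuous v ∧ (∀ t, |v t| ≤ K * B) ∧ (∀ t, τ ≤ t → v t = 0) ∧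
        ∀ k, laplace τ v (eigenvalue k) = β k := by
  set A := 4 / ∫ t in (0 : ℝ)..τ, gevreyBump τ t
  have hA : 0 < A := div_pos four_pos (integral_gevreyBump_pos hτ)
  have hexp := summable_exp_neg_mul_eigenvalue hτ
  refine ⟨A * ∑' n : ℕ+, Real.exp (-(τ * eigenvalue n)),
    mul_pos hA (hexp.tsum_pos (fun n => (Real.exp_nonneg _)) 1 (Real.exp_pos _)),
    fun β B hβ => ⟨fun t => ∑' n, β n * biorthogonal τ n t, ?_⟩⟩
  have hcont : ∀ n, Continuous fun t => β n * biorthogonal τ n t := fun n =>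
    (continuous_biorthogonal τ n).const_mul _
  have hbound : ∀ n t, |β n * biorthogonal τ n t| ≤ A * B * Real.exp (-(τ * eigenvalue n)) := by
    intro n t
    rw [abs_mul]
    calc |β n| * |biorthogonal τ n t|
        ≤ B * Real.exp (-(4 * τ * eigenvalue n)) * (A * Real.exp (3 * τ * eigenvalue n)) :=
          mul_le_mul (hβ n) (abs_biorthogonal_le hτ n t) (abs_nonneg _)
            ((abs_nonneg _).trans (hβ n))
      _ = A * B * Real.exp (-(4 * τ * eigenvalue n) + 3 * τ * eigenvalue n) := by
          rw [Real.exp_add]; ring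
      _ = A * B * Real.exp (-(τ * eigenvalue n)) := by ring_nf
  have hsum := hexp.mul_left (A * B)
  refine ⟨continuous_tsum hcont hsum hbound, fun t => ?_, fun t ht => ?_, fun k => ?_⟩
  · rw [mul_right_comm, ← tsum_mul_left]
    exact tsum_of_norm_bounded (f := fun n => β n * biorthogonal τ n t) hsum.hasSum
      fun n => hbound n t
  · simp only [biorthogonal_of_le _ ht, mul_zero, tsum_zero]
  · refine (hasSum_laplace hcont hsum hbound τ (eigenvalue k)).unique ?_
    simp only [laplace_const_mul, laplace_biorthogonal hτ, mul_ite, mul_one, mul_zero]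
    simpa only [if_pos] using hasSum_single (f := fun n => if n = k then β n else 0) k
      fun n hn => if_neg hn

theorem exists_control_moments {C α T : ℝ} {a : ℕ+ → ℝ} (hC : 0 < C) (hα : 0 ≤ α) (hT : α < T)
    (ha : ∀ n, C * Real.exp (-(α * eigenvalue n)) ≤ |a n|) :
    ∃ K > 0, ∀ (z : ℕ+ → ℝ) (B : ℝ), (∀ n, |z n| ≤ B) →
      ∃ v : ℝ → ℝ, Continuous v ∧ (∀ t, |v t| ≤ K * B) ∧
        ∀ k, a k * laplace T v (eigenvalue k) = -(Real.exp (-eigenvalue k * T) * z k) := by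
  obtain ⟨K, hK, hmoment⟩ := exists_laplace_eq (τ := (T - α) / 4) (by linarith)
  have hapos : ∀ n, 0 < |a n| := fun n => (mul_pos hC (Real.exp_pos _)).trans_le (ha n)
  refine ⟨K / C, div_pos hK hC, fun z B hz => ?_⟩
  obtain ⟨v, hvc, hvB, hvτ, hv⟩ :=
    hmoment (fun k => -(Real.exp (-eigenvalue k * T) * z k) / a k) (B / C) fun n => by
      have hB : 0 ≤ B := (abs_nonneg _).trans (hz n)
      rw [abs_div, abs_neg, abs_mul, Real.abs_exp]
      calc Real.exp (-eigenvalue n * T) * |z n| / |a n|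
          ≤ Real.exp (-eigenvalue n * T) * B / (C * Real.exp (-(α * eigenvalue n))) := by
            gcongr
            exacts [hz n, ha n]
        _ = B / C * Real.exp (-eigenvalue n * T + α * eigenvalue n) := by
            rw [Real.exp_add, Real.exp_neg (α * _)]
            field_simp
        _ = B / C * Real.exp (-(4 * ((T - α) / 4) * eigenvalue n)) := by ring_nf
  refine ⟨v, hvc, fun t => (hvB t).trans_eq (by ring), fun k => ?_⟩
  rw [laplace_eq_of_le hvc hvτ (by linarith), hv, mul_div_cancel₀ _ (abs_pos.1 (hapos k))]

end Moments

section Orthonormal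

open Filter Topology

variable {ι E X : Type*} [NormedAddCommGroup E] [InnerProductSpace ℝ E] [CompleteSpace E]
  {v : ι → E}

theorem summable_smul_of_orthonormal (hv : Orthonormal ℝ v) {c : ι → ℝ}
    (hc : Summable fun i => c i ^ 2) : Summable fun i => c i • v i := by
  have hsum := hv.orthogonalFamily.summable_iff_norm_sq_summable c
  simp only [Real.norm_eq_abs, sq_abs] at hsum
  simpa only [LinearIsometry.toSpanSingleton_apply] using hsum.2 hc

theorem inner_tsum_smul_of_orthonormal (hv : Orthonormal ℝ v) {c : ι → ℝ}
    (hc : Summable fun i => c i ^ 2) (k : ι) : inner ℝ (v k) (∑' i, c i • v i) = c k := by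
  classical
  have hsum := (summable_smul_of_orthonormal hv hc).hasSum.mapL (innerSL ℝ (v k))
  refine hsum.unique ?_
  simp only [innerSL_apply_apply, inner_smul_right, orthonormal_iff_ite.1 hv, mul_ite, mul_one,
    mul_zero, eq_comm (a := k)]
  simpa only [if_pos] using hasSum_single (f := fun i => if i = k then c i else 0) k
    fun i hi => if_neg hi

theorem norm_tsum_smul_sq_of_orthonormal (hv : Orthonormal ℝ v) {c : ι → ℝ}
    (hc : Summable fun i => c i ^ 2) : ‖∑' i, c i • v i‖ ^ 2 = ∑' i, c i ^ 2 := by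
  have hsum := (summable_smul_of_orthonormal hv hc).hasSum.mapL (innerSL ℝ (∑' i, c i • v i))
  rw [← real_inner_self_eq_norm_sq, ← innerSL_apply_apply, ← hsum.tsum_eq]
  refine tsum_congr fun i => ?_
  rw [innerSL_apply_apply, inner_smul_right, real_inner_comm,
    inner_tsum_smul_of_orthonormal hv hc, sq]

theorem continuousOn_tsum_smul_of_orthonormal [TopologicalSpace X] (hv : Orthonormal ℝ v)
    {c : ι → X → ℝ} {s : Set X} (hc : ∀ i, ContinuousOn (c i) s) {b : ι → ℝ}
    (hb : Summable fun i => b i ^ 2) (hcb : ∀ i, ∀ x ∈ s, |c i x| ≤ b i) :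
    ContinuousOn (fun x => ∑' i, c i x • v i) s := by
  intro x₀ hx₀
  have hsq : ∀ x ∈ s, Summable fun i => c i x ^ 2 := fun x hx =>
    .of_nonneg_of_le (fun i => sq_nonneg _) (fun i => sq_le_sq' (abs_le.1 (hcb i x hx)).1
      (abs_le.1 (hcb i x hx)).2) hb
  have hdiff_le : ∀ i, ∀ x ∈ s, (c i x - c i x₀) ^ 2 ≤ 4 * b i ^ 2 := fun i x hx => by
    have habs : |c i x - c i x₀| ≤ 2 * b i :=
      (abs_sub _ _).trans (by linarith [hcb i x hx, hcb i x₀ hx₀])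
    rw [← sq_abs]
    exact (pow_le_pow_left₀ (abs_nonneg _) habs 2).trans_eq (by ring)
  have hnorm : ∀ x ∈ s, ‖∑' i, c i x • v i - ∑' i, c i x₀ • v i‖
      = √(∑' i, (c i x - c i x₀) ^ 2) := fun x hx => by
    have hdiff : Summable fun i => (c i x - c i x₀) ^ 2 :=
      .of_nonneg_of_le (fun i => sq_nonneg _) (fun i => hdiff_le i x hx) (hb.mul_left 4)
    rw [← norm_tsum_smul_sq_of_orthonormal hv hdiff, Real.sqrt_sq (norm_nonneg _),
      ← (summable_smul_of_orthonormal hv (hsq x hx)).tsum_sub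
        (summable_smul_of_orthonormal hv (hsq x₀ hx₀))]
    simp only [sub_smul]
  have hlim : Tendsto (fun x => ∑' i, (c i x - c i x₀) ^ 2) (𝓝[s] x₀)
      (𝓝 (∑' i, (c i x₀ - c i x₀) ^ 2)) :=
    tendsto_tsum_of_dominated_convergence (hb.mul_left 4)
      (fun i => ((hc i x₀ hx₀).sub_const _).pow 2) (by
        filter_upwards [self_mem_nhdsWithin] with x hx i
        rw [Real.norm_of_nonneg (sq_nonneg _)]
        exact hdiff_le i x hx)
  refine tendsto_iff_norm_sub_tendsto_zero.2 (Tendsto.congr' ?_ (by simpa using hlim.sqrt))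
  filter_upwards [self_mem_nhdsWithin] with x hx using (hnorm x hx).symm

end Orthonormal

section Convolution

variable {E : Type*} [NormedAddCommGroup E] [NormedSpace ℝ E] {h : ℝ → ℝ} {k : ℝ → E} {t T : ℝ}

theorem intervalIntegrable_smul_comp_sub (hh : Continuous h) (ht : 0 ≤ t)
    (hk : IntegrableOn k (Ioc 0 t)) :
    IntervalIntegrable (fun r => h r • k (t - r)) volume 0 t := by
  have hk' : IntervalIntegrable k volume 0 t :=
    (intervalIntegrable_iff_integrableOn_Ioc_of_le ht).2 hk
  have hsub := (hk'.comp_sub_left t).symm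
  rw [sub_self, sub_zero] at hsub
  exact hsub.continuousOn_smul hh.continuousOn

theorem continuousOn_integral_smul_comp_sub (hh : Continuous h) {B : ℝ} (hB : ∀ r, |h r| ≤ B)
    (hk : IntegrableOn k (Ioc 0 T)) :
    ContinuousOn (fun t => ∫ r in (0 : ℝ)..t, h r • k (t - r)) (Icc 0 T) := by
  set k₀ := (Ioc 0 T).indicator k
  have hk₀ : Integrable k₀ := hk.integrable_indicator measurableSet_Ioc
  have heq : EqOn (fun t => ∫ r in (0 : ℝ)..t, h r • k (t - r))
      (fun t => ∫ r in (0 : ℝ)..t, h (t - r) • k₀ r) (Icc 0 T) := fun t ht => by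
    have hreflect := intervalIntegral.integral_comp_sub_left (a := 0) (b := t)
      (fun r => h (t - r) • k r) t
    simp only [sub_sub_cancel, sub_self, sub_zero] at hreflect
    refine hreflect.trans (intervalIntegral.integral_congr_Ioo_of_le ht.1 fun r hr => ?_)
    have hrT : r ∈ Ioc 0 T := ⟨hr.1, hr.2.le.trans ht.2⟩
    exact congrArg (h (t - r) • ·) (indicator_of_mem hrT k).symm
  refine ContinuousOn.congr (fun t _ => ContinuousAt.continuousWithinAt ?_) heq
  suffices hpair : ContinuousAt (fun p : ℝ × ℝ => ∫ r in (0 : ℝ)..p.2, h (p.1 - r) • k₀ r) (t, t)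
    from hpair.comp (f := fun t => (t, t)) (by fun_prop)
  refine intervalIntegral.continuousAt_parametric_primitive_of_dominated
    (F := fun t r => h (t - r) • k₀ r) (fun r => B * ‖k₀ r‖) (-|t| - 1) (|t| + 1) (fun t' => ?_)
    (.of_forall fun t' => .of_forall fun r => ?_) ?_ (.of_forall fun r => ?_) ?_ ?_ ?_
  · exact ((Continuous.aestronglyMeasurable (by fun_prop)).smul hk₀.1).restrict
  · rw [norm_smul]
    exact mul_le_mul_of_nonneg_right (hB _) (norm_nonneg _)
  · exact (hk₀.norm.const_mul B).intervalIntegrable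
  · fun_prop
  · constructor <;> linarith [abs_nonneg t]
  · constructor <;> linarith [neg_abs_le t, le_abs_self t]
  · exact measure_singleton t

end Convolution

section Orthonormality

theorem inner_e (n k : ℕ+) :
    inner ℝ (e n) (e k) = ∫ x in (0 : ℝ)..1, sineFun n x * sineFun k x := by
  rw [L2.inner_def, intervalIntegral.integral_of_le zero_le_one, integral_Ioc_eq_integral_Ioo]
  refine integral_congr_ae ?_
  filter_upwards [(memLp_sineFun n).coeFn_toLp, (memLp_sineFun k).coeFn_toLp] with x hn hk
  rw [e, e, hn, hk, RCLike.inner_apply', conj_trivial]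

theorem sineFun_mul_sineFun (n k : ℕ+) (x : ℝ) : sineFun n x * sineFun k x =
    Real.cos (Real.pi * (n - k : ℤ) * x) - Real.cos (Real.pi * (n + k : ℤ) * x) := by
  have htwo : √2 * √2 = (2 : ℝ) := Real.mul_self_sqrt zero_le_two
  rw [sineFun, sineFun]
  push_cast
  rw [mul_sub, mul_add, sub_mul, add_mul, Real.cos_sub, Real.cos_add]
  linear_combination (Real.sin (Real.pi * n * x) * Real.sin (Real.pi * k * x)) * htwo

theorem integral_cos_pi_mul_int {m : ℤ} (hm : m ≠ 0) :
    ∫ x in (0 : ℝ)..1, Real.cos (Real.pi * m * x) = 0 := by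
  have hc : Real.pi * (m : ℝ) ≠ 0 := mul_ne_zero Real.pi_ne_zero (Int.cast_ne_zero.2 hm)
  rw [intervalIntegral.integral_comp_mul_left (fun x => Real.cos x) hc, integral_cos, mul_zero,
    mul_one, Real.sin_zero, mul_comm Real.pi, Real.sin_int_mul_pi, sub_zero, smul_zero]

theorem orthonormal_e : Orthonormal ℝ e := by
  refine orthonormal_iff_ite.2 fun n k => ?_
  have hint : ∀ m : ℤ, IntervalIntegrable (fun x => Real.cos (Real.pi * m * x)) volume 0 1 :=
    fun m => Continuous.intervalIntegrable (by fun_prop) _ _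
  have hpos : (n + k : ℤ) ≠ 0 := by have := n.pos; positivity
  simp only [inner_e, sineFun_mul_sineFun]
  rw [intervalIntegral.integral_sub (hint _) (hint _), integral_cos_pi_mul_int hpos, sub_zero]
  split_ifs with hnk
  · simp [hnk]
  · exact integral_cos_pi_mul_int (sub_ne_zero.2 fun h => hnk (PNat.coe_injective (mod_cast h)))

end Orthonormality

section HeatSemigroup

variable {a : ℕ+ → ℝ} {s σ t : ℝ}

theorem exp_neg_mul_sq_le_rpow {x : ℝ} (hσ₀ : 0 ≤ σ) (hσ₂ : σ ≤ 2) (hx : 0 < x) :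
    Real.exp (-x) ^ 2 ≤ x ^ (-σ) := by
  rw [← Real.exp_nat_mul, Real.rpow_def_of_pos hx, Real.exp_le_exp]
  push_cast
  nlinarith [Real.log_le_self hx.le]

theorem exp_neg_eigenvalue_mul_sq_le (hσ₀ : 0 ≤ σ) (hσ₂ : σ ≤ 2) (ht : 0 < t) (n : ℕ+) (c : ℝ) :
    (Real.exp (-eigenvalue n * t) * c) ^ 2 ≤ t ^ (-σ) * (eigenvalue n ^ (-σ) * |c| ^ 2) := by
  have hle := exp_neg_mul_sq_le_rpow hσ₀ hσ₂ (mul_pos (eigenvalue_pos n) ht)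
  rw [Real.mul_rpow (eigenvalue_pos n).le ht.le] at hle
  rw [mul_pow, neg_mul, ← sq_abs c]
  exact (mul_le_mul_of_nonneg_right hle (sq_nonneg _)).trans_eq (by ring)

theorem abs_exp_neg_eigenvalue_mul_le {t₀ : ℝ} (ht : t₀ ≤ t) (n : ℕ+) (c : ℝ) :
    |Real.exp (-eigenvalue n * t) * c| ≤ |Real.exp (-eigenvalue n * t₀) * c| := by
  rw [abs_mul, abs_mul, Real.abs_exp, Real.abs_exp]
  gcongr ?_ * _
  exact Real.exp_le_exp.2 (mul_le_mul_of_nonpos_left ht (neg_nonpos.2 (eigenvalue_pos n).le))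

theorem continuousOn_heatSeries_Ici {t₀ : ℝ}
    (ha : Summable fun n => (Real.exp (-eigenvalue n * t₀) * a n) ^ 2) :
    ContinuousOn (heatSeries a) (Ici t₀) :=
  continuousOn_tsum_smul_of_orthonormal orthonormal_e (fun n => by fun_prop)
    (ha.congr fun n => (sq_abs _).symm) fun n _ ht => abs_exp_neg_eigenvalue_mul_le ht n (a n)

theorem inner_heatSeries_eq_zero {w : L2 1} (hw : ∀ n, inner ℝ w (e n) = 0) (a : ℕ+ → ℝ) (t : ℝ) :
    inner ℝ w (heatSeries a t) = 0 := by
  by_cases hsum : Summable fun n => (Real.exp (-eigenvalue n * t) * a n) • e n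
  · refine (hsum.hasSum.mapL (innerSL ℝ w)).unique (hasSum_zero.congr_fun fun n => ?_)
    rw [innerSL_apply_apply, inner_smul_right, hw, mul_zero]
  · rw [heatSeries, tsum_eq_zero_of_not_summable hsum, inner_zero_right]

theorem summable_exp_mul_inner_e_sq (ht : 0 ≤ t) (z : L2 1) :
    Summable fun n => (Real.exp (-eigenvalue n * t) * inner ℝ z (e n)) ^ 2 := by
  refine .of_nonneg_of_le (fun n => sq_nonneg _) (fun n => ?_)
    (orthonormal_e.inner_products_summable (x := z))
  rw [Real.norm_eq_abs, real_inner_comm, ← sq_abs]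
  refine pow_le_pow_left₀ (abs_nonneg _) ((abs_exp_neg_eigenvalue_mul_le ht n _).trans_eq ?_) 2
  rw [mul_zero, Real.exp_zero, one_mul]

theorem continuousOn_heat (z : L2 1) : ContinuousOn (fun t => heat t z) (Ici 0) :=
  continuousOn_heatSeries_Ici (summable_exp_mul_inner_e_sq le_rfl z)

theorem inner_e_heat (ht : 0 ≤ t) (z : L2 1) (n : ℕ+) :
    inner ℝ (e n) (heat t z) = Real.exp (-eigenvalue n * t) * inner ℝ z (e n) :=
  inner_tsum_smul_of_orthonormal orthonormal_e (summable_exp_mul_inner_e_sq ht z) n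

theorem NegSobolev.summable_of_le (f : NegSobolev s) (hσ : s ≤ σ) :
    Summable fun n => eigenvalue n ^ (-σ) * |f.coeff n| ^ 2 :=
  .of_nonneg_of_le
    (fun n => mul_nonneg (Real.rpow_nonneg (eigenvalue_pos n).le _) (sq_nonneg _))
    (fun n => mul_le_mul_of_nonneg_right
      (Real.rpow_le_rpow_of_exponent_le (one_le_eigenvalue n) (neg_le_neg hσ)) (sq_nonneg _))
    f.summable_coeff

theorem summable_exp_mul_coeff_sq (hs : s ≤ 2) (f : NegSobolev s) (ht : 0 < t) :
    Summable fun n => (Real.exp (-eigenvalue n * t) * f.coeff n) ^ 2 :=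
  .of_nonneg_of_le (fun _ => sq_nonneg _)
    (fun n => exp_neg_eigenvalue_mul_sq_le zero_le_two le_rfl ht n _)
    ((f.summable_of_le hs).mul_left _)

theorem inner_e_heatExt (hs : s ≤ 2) (f : NegSobolev s) (ht : 0 < t) (n : ℕ+) :
    inner ℝ (e n) (heatExt t f) = Real.exp (-eigenvalue n * t) * f.coeff n :=
  inner_tsum_smul_of_orthonormal orthonormal_e (summable_exp_mul_coeff_sq hs f ht) n

theorem continuousOn_heatExt (hs : s ≤ 2) (f : NegSobolev s) :
    ContinuousOn (fun t => heatExt t f) (Ioi 0) := fun _ ht =>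
  ((continuousOn_heatSeries_Ici (summable_exp_mul_coeff_sq hs f (half_pos ht))).continuousAt
    (Ici_mem_nhds (half_lt_self ht))).continuousWithinAt

theorem norm_heatExt_le (f : NegSobolev s) (hσ : s ≤ σ) (hσ₀ : 0 ≤ σ) (hσ₂ : σ ≤ 2) (ht : 0 < t) :
    ‖heatExt t f‖ ≤ √(∑' n, eigenvalue n ^ (-σ) * |f.coeff n| ^ 2) * t ^ (-σ / 2) := by
  have hnorm : ‖heatExt t f‖ ^ 2 ≤ t ^ (-σ) * ∑' n, eigenvalue n ^ (-σ) * |f.coeff n| ^ 2 := by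
    have hsum := summable_exp_mul_coeff_sq (hσ.trans hσ₂) f ht
    rw [heatExt, heatSeries, norm_tsum_smul_sq_of_orthonormal orthonormal_e hsum, ← tsum_mul_left]
    exact hsum.tsum_le_tsum (fun n => exp_neg_eigenvalue_mul_sq_le hσ₀ hσ₂ ht n _)
      ((f.summable_of_le hσ).mul_left _)
  refine (Real.le_sqrt_of_sq_le hnorm).trans_eq ?_
  rw [Real.sqrt_mul (Real.rpow_nonneg ht.le _), mul_comm, Real.sqrt_eq_rpow (t ^ (-σ)),
    ← Real.rpow_mul ht.le]
  ring_nf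

-- The bound `‖S(t) f‖ ≲ t ^ (-σ / 2)` with `σ = max s 0` is integrable at `0` since `s < 2`.
theorem integrableOn_heatExt (hs : s < 2) (f : NegSobolev s) (T : ℝ) :
    IntegrableOn (fun t => heatExt t f) (Ioc 0 T) := by
  have hpow : IntegrableOn (fun t : ℝ => t ^ (-max s 0 / 2)) (Ioc 0 T) :=
    (intervalIntegral.intervalIntegrable_rpow' (a := 0) (b := T)
      (by linarith [max_lt hs two_pos])).1
  refine (hpow.const_mul (√(∑' n, eigenvalue n ^ (-max s 0) * |f.coeff n| ^ 2))).mono'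
    (((continuousOn_heatExt hs.le f).mono Ioc_subset_Ioi_self).aestronglyMeasurable
      measurableSet_Ioc) ?_
  filter_upwards [ae_restrict_mem measurableSet_Ioc] with t ht
  exact norm_heatExt_le f (le_max_left s 0) (le_max_right s 0) (max_lt hs two_pos).le ht.1

end HeatSemigroup

section MildSolution

variable {s t T : ℝ} {f : NegSobolev s} {h : ℝ → ℝ} {u : L2 T} {z₀ : L2 1} {z : ℝ → L2 1}

theorem ae_eq_uIoc_of_ae_eq_Ioo {g : ℝ → ℝ} (hu : g =ᵐ[volume.restrict (Ioo (0 : ℝ) T)] h)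
    (ht : t ∈ Icc 0 T) : g =ᵐ[volume.restrict (uIoc 0 t)] h := by
  rw [uIoc_of_le ht.1, ← restrict_Ioo_eq_restrict_Ioc]
  exact ae_restrict_of_ae_restrict_of_subset (Ioo_subset_Ioo_right ht.2) hu

theorem isMildSolution_of_ae_eq (hs : s < 2) (f : NegSobolev s) (hh : Continuous h) {B : ℝ}
    (hB : ∀ r, |h r| ≤ B) (hu : u =ᵐ[volume.restrict (Ioo (0 : ℝ) T)] h) (z₀ : L2 1) :
    IsMildSolution f T u z₀
      fun t => heat t z₀ + ∫ r in (0 : ℝ)..t, u r • heatExt (t - r) f := by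
  have hconv : ∀ t ∈ Icc (0 : ℝ) T, (fun r => h r • heatExt (t - r) f)
      =ᵐ[volume.restrict (uIoc 0 t)] fun r => u r • heatExt (t - r) f := fun t ht => by
    filter_upwards [ae_eq_uIoc_of_ae_eq_Ioo hu ht] with r hr
    rw [hr]
  refine ⟨((continuousOn_heat z₀).mono Icc_subset_Ici_self).add ?_, fun t ht => ?_,
    fun t _ => rfl⟩
  · exact (continuousOn_integral_smul_comp_sub hh hB (integrableOn_heatExt hs f T)).congr
      fun t ht => (intervalIntegral.integral_congr_ae_restrict (hconv t ht)).symm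
  · exact (intervalIntegrable_smul_comp_sub hh ht.1
      (integrableOn_heatExt hs f t)).congr_ae (hconv t ht)

theorem IsMildSolution.inner_e (hz : IsMildSolution f T u z₀ z) (hs : s ≤ 2) (ht : t ∈ Icc 0 T)
    (n : ℕ+) : inner ℝ (e n) (z t) = Real.exp (-eigenvalue n * t) * inner ℝ z₀ (e n) +
      f.coeff n * ∫ r in (0 : ℝ)..t, u r * Real.exp (-eigenvalue n * (t - r)) := by
  have hmode : ∀ r ∈ Ioo 0 t, inner ℝ (e n) (u r • heatExt (t - r) f)
      = f.coeff n * (u r * Real.exp (-eigenvalue n * (t - r))) := fun r hr => by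
    rw [inner_smul_right, inner_e_heatExt hs f (sub_pos.2 hr.2)]
    ring
  have hduhamel := (innerSL ℝ (e n)).intervalIntegral_comp_comm (hz.integrable t ht)
  simp only [innerSL_apply_apply] at hduhamel
  rw [hz.eq_mild t ht, inner_add_right, inner_e_heat ht.1, ← hduhamel,
    intervalIntegral.integral_congr_Ioo_of_le ht.1 hmode, intervalIntegral.integral_const_mul]

-- No completeness of the sine system is needed: `z t` lies in its closed span by construction.
theorem IsMildSolution.eq_zero_of_inner_e_eq_zero (hz : IsMildSolution f T u z₀ z)
    (ht : t ∈ Icc 0 T) (hzero : ∀ n, inner ℝ (e n) (z t) = 0) : z t = 0 := by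
  have horth : ∀ a r, inner ℝ (z t) (heatSeries a r) = 0 :=
    inner_heatSeries_eq_zero fun n => (real_inner_comm _ _).trans (hzero n)
  have hduhamel := (innerSL ℝ (z t)).intervalIntegral_comp_comm (hz.integrable t ht)
  simp only [innerSL_apply_apply, inner_smul_right, heatExt, horth, mul_zero,
    intervalIntegral.integral_zero] at hduhamel
  have hself : inner ℝ (z t) (z t) = 0 := by
    nth_rewrite 2 [hz.eq_mild t ht]
    rw [inner_add_right, heat, horth]
    simpa only [heatExt, zero_add] using hduhamel.symm
  exact inner_self_eq_zero.1 hself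

theorem IsMildSolution.eq_zero_of_laplace {v : ℝ → ℝ} (hz : IsMildSolution f T u z₀ z)
    (hs : s ≤ 2) (hT : 0 ≤ T) (hu : u =ᵐ[volume.restrict (Ioo (0 : ℝ) T)] fun r => v (T - r))
    (hv : ∀ n, f.coeff n * laplace T v (eigenvalue n)
      = -(Real.exp (-eigenvalue n * T) * inner ℝ z₀ (e n))) : z T = 0 := by
  have hTmem : T ∈ Icc 0 T := right_mem_Icc.2 hT
  refine hz.eq_zero_of_inner_e_eq_zero hTmem fun n => ?_
  have hreflect : ∫ r in (0 : ℝ)..T, u r * Real.exp (-eigenvalue n * (T - r))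
      = laplace T v (eigenvalue n) := by
    have hsub := intervalIntegral.integral_comp_sub_left (a := 0) (b := T)
      (fun r => v r * Real.exp (-eigenvalue n * r)) T
    rw [sub_self, sub_zero] at hsub
    refine (intervalIntegral.integral_congr_ae_restrict ?_).trans hsub
    filter_upwards [ae_eq_uIoc_of_ae_eq_Ioo hu hTmem] with r hr
    rw [hr]
  rw [hz.inner_e hs hTmem, hreflect, hv, add_neg_cancel]

theorem norm_toLp_le_sqrt_mul (hT : 0 ≤ T) {B : ℝ} (hB : ∀ r, |h r| ≤ B)
    (hh : MemLp h 2 (volume.restrict (Ioo (0 : ℝ) T))) : ‖hh.toLp h‖ ≤ √T * B := by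
  have hB₀ : 0 ≤ B := (abs_nonneg _).trans (hB 0)
  have hbound : ∀ᵐ r ∂volume.restrict (Ioo (0 : ℝ) T), ‖hh.toLp h r‖ ≤ B := by
    filter_upwards [hh.coeFn_toLp] with r hr
    rw [hr]
    exact hB r
  refine (Lp.norm_le_of_ae_bound hB₀ hbound).trans_eq ?_
  have hvol : (measureUnivNNReal (volume.restrict (Ioo (0 : ℝ) T)) : ℝ) = T := by
    simp [measureUnivNNReal, ENNReal.coe_toNNReal_eq_toReal, hT]
  rw [hvol, Real.sqrt_eq_rpow]
  norm_num

end MildSolution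

end HeatControl

end

theorem proposition3p1_general (C α s : ℝ) (hC : 0 < C) (hα : 0 ≤ α) (hs : s < 2)
    (f : HeatControl.NegSobolev s)
    (hf : ∀ n : ℕ+, C * Real.exp (-α * Real.pi ^ 2 * (n : ℝ) ^ 2) ≤ |f.coeff n|)
    (T : ℝ) (hT : α < T) :
    HeatControl.IsNullControllable f T := by
  have hT₀ : 0 < T := hα.trans_lt hT
  obtain ⟨K, hK, hcontrol⟩ := HeatControl.exists_control_moments (a := f.coeff) hC hα hT fun n => by
    simpa only [HeatControl.eigenvalue, neg_mul, mul_assoc] using hf n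
  refine ⟨√T * K, by positivity, fun z₀ => ?_⟩
  obtain ⟨v, hvc, hvB, hv⟩ := hcontrol (fun n => inner ℝ z₀ (HeatControl.e n)) ‖z₀‖ fun n => by
    simpa only [HeatControl.orthonormal_e.1 n, mul_one] using
      abs_real_inner_le_norm z₀ (HeatControl.e n)
  have hhc : Continuous fun r => v (T - r) := by fun_prop
  have hhB : ∀ r, |v (T - r)| ≤ K * ‖z₀‖ := fun r => hvB (T - r)
  have hh : MemLp (fun r => v (T - r)) 2 (volume.restrict (Ioo (0 : ℝ) T)) :=
    .of_bound hhc.aestronglyMeasurable (K * ‖z₀‖) (.of_forall hhB)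
  have hz := HeatControl.isMildSolution_of_ae_eq hs f hhc hhB hh.coeFn_toLp z₀
  exact ⟨hh.toLp _, _, hz, hz.eq_zero_of_laplace hs.le hT₀.le hh.coeFn_toLp hv,
    (HeatControl.norm_toLp_le_sqrt_mul hT₀.le hhB hh).trans_eq (mul_assoc _ _ _).symm⟩

theorem proposition3p1 (C α s : ℝ) (hC : 0 < C) (hα : 0 < α) (hs : s ∈ Set.Ico (0 : ℝ) 1)
    (f : HeatControl.NegSobolev s)
    (hf : ∀ n : ℕ+, C * Real.exp (-α * Real.pi ^ 2 * (n : ℝ) ^ 2) ≤ |f.coeff n|)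
    (T : ℝ) (hT : α < T) :
    HeatControl.IsNullControllable f T :=
  proposition3p1_general C α s hC hα.le (hs.2.trans one_lt_two) f hf T hT
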